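/- \textbf{Corollary ($L^p$ $k$-forms).} Let $(M,g_M)$ and $(N,g_N)$ be oriented, $n$-dimensional smooth Riemannian manifolds (Hausdorff, second countable, without boundary), with Riemannian volume forms $\mu_M$ and $\mu_N$, and let $\varphi\colon M\to N$ be an orientation-preserving diffeomorphism. For $x\in M$ let $\alpha_1(x)\ge\cdots\ge\alpha_n(x)>0$ be the singular values of $\varphi$ at $x$, i.e. the singular values of the tangent map $T_x\varphi\colon T_xM\to T_{\varphi(x)}N$ with respect to the inner products $g_M$ and $g_N$. For a $k$-form $\omega$ let $$|\omega|_x=\sup_{0\ne X_1,\dots,X_k\in T_xM}\frac{|\omega_x(X_1,\dots,X_k)|}{|X_1|\cdots|X_k|}$$ be its pointwise spectral norm, let $\|\omega\|_p$ be the $L^p$ norm of the function $x\mapsto|\omega|_x$ with respect to $\mu_M$ (the essential supremum if $p=\infty$), and let $L^p\Omega^k(M)$ be the space of measurable $k$-forms with $\|\omega\|_p<\infty$, modulo equality almost everywhere; similarly on $N$. Write $\varphi_*\omega=(\varphi^{-1})^*\omega$ for the pushforward. Let $p,q\in[1,\infty]$ with $1/p+1/q=1$, let $0\le k\le n$, and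 suppose that the product $(\alpha_1\cdots\alpha_{n-k})^{1/p}(\alpha_{n-k+1}\cdots\alpha_n)^{-1/q}$ is bounded uniformly on $M$. Then for every $\omega\in L^p\Omega^k(M)$ the pushforward $\varphi_*\omega$ is a well-defined element of $L^p\Omega^k(N)$ (almost everywhere equal forms have almost everywhere equal pushforwards), and $$\bigl\|(\alpha_1\cdots\alpha_k)^{1/q}(\alpha_{k+1}\cdots\alpha_n)^{-1/p}\bigr\|_\infty^{-1}\,\|\omega\|_p\ \le\ \|\varphi_*\omega\|_p\ \le\ \bigl\|(\alpha_1\cdots\alpha_{n-k})^{1/p}(\alpha_{n-k+1}\cdots\alpha_n)^{-1/q}\bigr\|_\infty\,\|\omega\|_p .$$ Here $\|\cdot\|_\infty$ is the essential supremum over $M$, $1/\infty=0$, empty products are $1$, and $\|\cdot\|_\infty^{-1}$ is read as $0$ if the norm is infinite. -/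

import Mathlib

open Bundle Manifold MeasureTheory
open scoped ContDiff Bundle ENNReal

noncomputable section

namespace RiemForms

/-! ### Tangent spaces of `n`-dimensional manifolds -/

section Tangent

variable {n : ℕ} {M : Type*} [TopologicalSpace M]
  [ChartedSpace (EuclideanSpace ℝ (Fin n)) M]

instance tangentFiniteDimensional (x : M) :
    FiniteDimensional ℝ (TangentSpace (𝓡 n) x) :=
  inferInstanceAs (FiniteDimensional ℝ (EuclideanSpace ℝ (Fin n)))

instance tangentFinrank (x : M) :
    Fact (Module.finrank ℝ (TangentSpace (𝓡 n) x) = n) :=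
  ⟨finrank_euclideanSpace_fin⟩

end Tangent

/-! ### Orientations -/

section Orientation

variable (n : ℕ) (M : Type*) [TopologicalSpace M]
  [ChartedSpace (EuclideanSpace ℝ (Fin n)) M]

/-- The differential at `x` of the preferred chart around `c`, as a linear isomorphism of the
tangent space `T_x M` with `ℝⁿ`; here `x` is any point of the domain of that chart. -/
def chartDifferential {n : ℕ} {M : Type*} [TopologicalSpace M]
    [ChartedSpace (EuclideanSpace ℝ (Fin n)) M] [IsManifold (𝓡 n) ∞ M] (c x : M)
    (hx : x ∈ (chartAt (EuclideanSpace ℝ (Fin n)) c).source) :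
    TangentSpace (𝓡 n) x ≃ₗ[ℝ] EuclideanSpace ℝ (Fin n) :=
  ((mdifferentiable_chart (I := 𝓡 n) c).mfderiv hx).toLinearEquiv

/-- An orientation of a smooth `n`-manifold: an orientation of each tangent space which, read in
any preferred chart as an orientation of `ℝⁿ`, is locally constant on the domain of the chart. -/
structure ManifoldOrientation [IsManifold (𝓡 n) ∞ M] where
  orient : (x : M) → Orientation ℝ (TangentSpace (𝓡 n) x) (Fin n)
  isLocallyConstant : ∀ c : M,
    IsLocallyConstant fun x : (chartAt (EuclideanSpace ℝ (Fin n)) c).source =>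
      Orientation.map (Fin n) (chartDifferential c x.1 x.2) (orient x.1)

end Orientation

/-- A diffeomorphism preserves orientations if each of its tangent maps does. -/
def IsOrientationPreserving {n : ℕ} {M N : Type*}
    [TopologicalSpace M] [ChartedSpace (EuclideanSpace ℝ (Fin n)) M] [IsManifold (𝓡 n) ∞ M]
    [TopologicalSpace N] [ChartedSpace (EuclideanSpace ℝ (Fin n)) N] [IsManifold (𝓡 n) ∞ N]
    (oM : ManifoldOrientation n M) (oN : ManifoldOrientation n N)
    (φ : M ≃ₘ⟮𝓡 n, 𝓡 n⟯ N) : Prop :=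
  ∀ x : M, Orientation.map (Fin n)
    (φ.mfderivToContinuousLinearEquiv (x := x) (by simp)).toLinearEquiv (oM.orient x)
      = oN.orient (φ x)

/-! ### Differential forms (not assumed continuous), pullback and pushforward -/

/-- A (rough) `k`-form on `M`: an alternating `k`-linear form on each tangent space. -/
abbrev KForm (n k : ℕ) (M : Type*) [TopologicalSpace M]
    [ChartedSpace (EuclideanSpace ℝ (Fin n)) M] :=
  (x : M) → TangentSpace (𝓡 n) x [⋀^Fin k]→ₗ[ℝ] ℝ

/-- The pullback `(f^* η)_x (X₁, …, X_k) = η_{f x} (T_x f X₁, …, T_x f X_k)`. -/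
def pullback {n k : ℕ} {M N : Type*}
    [TopologicalSpace M] [ChartedSpace (EuclideanSpace ℝ (Fin n)) M]
    [TopologicalSpace N] [ChartedSpace (EuclideanSpace ℝ (Fin n)) N]
    (f : M → N) (η : KForm n k N) : KForm n k M :=
  fun x => (η (f x)).compLinearMap (mfderiv (𝓡 n) (𝓡 n) f x).toLinearMap

/-- The pushforward by a diffeomorphism, `φ_* = (φ⁻¹)^*`. -/
def pushforward {n k : ℕ} {M N : Type*}
    [TopologicalSpace M] [ChartedSpace (EuclideanSpace ℝ (Fin n)) M]
    [TopologicalSpace N] [ChartedSpace (EuclideanSpace ℝ (Fin n)) N]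
    (φ : M ≃ₘ⟮𝓡 n, 𝓡 n⟯ N) (θ : KForm n k M) : KForm n k N :=
  pullback φ.symm θ

section Measurability

variable {n k : ℕ} {M : Type*} [TopologicalSpace M]
  [ChartedSpace (EuclideanSpace ℝ (Fin n)) M]

/-- For a point `y` of `ℝⁿ` in the target of the preferred chart `e` around `c`, the differential
of `e⁻¹` at `y`. It maps the standard basis of `ℝⁿ` to the coordinate vectors `∂₁, …, ∂ₙ`. -/
def coordVector (c : M) (y : EuclideanSpace ℝ (Fin n)) :
    EuclideanSpace ℝ (Fin n) →ₗ[ℝ]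
      TangentSpace (𝓡 n) ((chartAt (EuclideanSpace ℝ (Fin n)) c).symm y) :=
  (mfderiv (𝓡 n) (𝓡 n) (chartAt (EuclideanSpace ℝ (Fin n)) c).symm y).toLinearMap

/-- A `k`-form is (almost everywhere) measurable if its coefficients in the preferred charts are
Lebesgue almost everywhere measurable. -/
def IsAEMeasurableForm (θ : KForm n k M) : Prop :=
  ∀ (c : M) (v : Fin k → EuclideanSpace ℝ (Fin n)),
    AEMeasurable
      (fun y => θ ((chartAt (EuclideanSpace ℝ (Fin n)) c).symm y)
        (fun i => coordVector c y (v i)))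
      (volume.restrict (chartAt (EuclideanSpace ℝ (Fin n)) c).target)

end Measurability

/-! ### Integration against the Riemannian volume form -/

section Volume

variable {n : ℕ} {M : Type*} [TopologicalSpace M]
  [ChartedSpace (EuclideanSpace ℝ (Fin n)) M] [IsManifold (𝓡 n) ∞ M]
  [RiemannianBundle (fun x : M => TangentSpace (𝓡 n) x)]

/-- The Riemannian volume form of an oriented Riemannian manifold: at each point, the `n`-form that
is `1` on the positively oriented orthonormal bases. -/
def volForm (o : ManifoldOrientation n M) : KForm n n M :=
  fun x => (o.orient x).volumeForm

/-- The measure on the domain of the preferred chart `e` around `c` (extended by zero to `M`) that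
has density `|μ_M(∂₁, …, ∂ₙ)|` with respect to Lebesgue measure in the coordinates of `e`. -/
def chartMeasure [MeasurableSpace M] (o : ManifoldOrientation n M) (c : M) : Measure M :=
  Measure.map (chartAt (EuclideanSpace ℝ (Fin n)) c).symm
    ((volume.restrict (chartAt (EuclideanSpace ℝ (Fin n)) c).target).withDensity fun y =>
      ENNReal.ofReal
        |volForm o ((chartAt (EuclideanSpace ℝ (Fin n)) c).symm y)
          (fun i => coordVector c y (EuclideanSpace.single i 1))|)

end Volume

/-- A second countable manifold has a measurable, countably valued choice `κ` of a chart around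
each point (the chart around `κ x` contains `x`). -/
theorem exists_chartSelector (n : ℕ) (M : Type*) [TopologicalSpace M]
    [SecondCountableTopology M] [ChartedSpace (EuclideanSpace ℝ (Fin n)) M]
    [MeasurableSpace M] [BorelSpace M] :
    ∃ κ : M → M, (Set.range κ).Countable ∧ (∀ c, MeasurableSet (κ ⁻¹' {c})) ∧
      ∀ x, x ∈ (chartAt (EuclideanSpace ℝ (Fin n)) (κ x)).source := by
  classical
  rcases isEmpty_or_nonempty M with hM | hM
  · exact ⟨id, Set.to_countable _, fun c => (hM.false c).elim, fun x => (hM.false x).elim⟩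
  obtain ⟨s, hs, hcov⟩ := TopologicalSpace.countable_cover_nhds
    (f := fun x : M => (chartAt (EuclideanSpace ℝ (Fin n)) x).source)
    (fun x => chart_source_mem_nhds _ x)
  have hne : s.Nonempty := by
    obtain ⟨x⟩ := hM
    have hx : x ∈ ⋃ y ∈ s, (chartAt (EuclideanSpace ℝ (Fin n)) y).source := hcov ▸ Set.mem_univ x
    simp only [Set.mem_iUnion] at hx
    obtain ⟨y, hy, -⟩ := hx
    exact ⟨y, hy⟩
  obtain ⟨c, rfl⟩ := hs.exists_eq_range hne
  have hex : ∀ x : M, ∃ i, x ∈ (chartAt (EuclideanSpace ℝ (Fin n)) (c i)).source := by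
    intro x
    have hx : x ∈ ⋃ y ∈ Set.range c, (chartAt (EuclideanSpace ℝ (Fin n)) y).source :=
      hcov ▸ Set.mem_univ x
    simpa using hx
  have hmeas : Measurable fun x => Nat.find (hex x) :=
    measurable_find hex fun i =>
      (chartAt (EuclideanSpace ℝ (Fin n)) (c i)).open_source.measurableSet
  refine ⟨fun x => c (Nat.find (hex x)), ?_, ?_, fun x => Nat.find_spec (hex x)⟩
  · exact (Set.countable_range c).mono (by rintro _ ⟨x, rfl⟩; exact ⟨_, rfl⟩)
  · intro d
    exact hmeas (MeasurableSet.of_discrete (s := c ⁻¹' {d}))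

/-- A fixed choice of a chart around each point, as above. -/
def chartSelector (n : ℕ) (M : Type*) [TopologicalSpace M]
    [SecondCountableTopology M] [ChartedSpace (EuclideanSpace ℝ (Fin n)) M]
    [MeasurableSpace M] [BorelSpace M] : M → M :=
  (exists_chartSelector n M).choose

/-- Integration against the Riemannian volume form `μ_M`, as a measure on `M`: the manifold is cut
into countably many Borel pieces, each inside the domain of a chart, and on each piece the measure
is given by the density `|μ_M(∂₁, …, ∂ₙ)|` in that chart. By the change of variables formula the
local measures of two charts agree on the overlap, so the result does not depend on the pieces. -/
def riemannianMeasure {n : ℕ} {M : Type*} [TopologicalSpace M] [SecondCountableTopology M]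
    [ChartedSpace (EuclideanSpace ℝ (Fin n)) M] [IsManifold (𝓡 n) ∞ M]
    [RiemannianBundle (fun x : M => TangentSpace (𝓡 n) x)]
    [MeasurableSpace M] [BorelSpace M] (o : ManifoldOrientation n M) : Measure M :=
  Measure.sum fun c : Set.range (chartSelector n M) =>
    (chartMeasure o c.1).restrict (chartSelector n M ⁻¹' {c.1})

/-! ### Spectral norm and `L^p` norms of forms -/

/-- The pointwise spectral norm: the supremum of `|θ_x(X₁, …, X_k)| / (|X₁| ⋯ |X_k|)` over nonzero
tangent vectors `X₁, …, X_k` at `x`. -/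
def spectralNorm {n k : ℕ} {M : Type*} [TopologicalSpace M]
    [ChartedSpace (EuclideanSpace ℝ (Fin n)) M]
    [RiemannianBundle (fun x : M => TangentSpace (𝓡 n) x)]
    (θ : KForm n k M) (x : M) : ℝ≥0∞ :=
  ⨆ (X : Fin k → TangentSpace (𝓡 n) x) (_ : ∀ i, X i ≠ 0),
    ENNReal.ofReal (|θ x X| / ∏ i, ‖X i‖)

section Lp

variable {n k : ℕ} {M : Type*} [TopologicalSpace M] [SecondCountableTopology M]
  [ChartedSpace (EuclideanSpace ℝ (Fin n)) M] [IsManifold (𝓡 n) ∞ M]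
  [RiemannianBundle (fun x : M => TangentSpace (𝓡 n) x)]
  [MeasurableSpace M] [BorelSpace M]

/-- The `L^p` norm of a `k`-form: the `L^p` norm of its pointwise spectral norm with respect to the
Riemannian volume (the essential supremum for `p = ∞`). -/
def formNorm (o : ManifoldOrientation n M) (p : ℝ≥0∞) (θ : KForm n k M) : ℝ≥0∞ :=
  eLpNorm (fun x => spectralNorm θ x) p (riemannianMeasure o)

/-- `θ` is (a representative of an element) in `L^p Ω^k(M)`: it is measurable with finite `L^p`
norm. -/
def MemLpForm (o : ManifoldOrientation n M) (p : ℝ≥0∞) (θ : KForm n k M) : Prop :=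
  IsAEMeasurableForm θ ∧ formNorm o p θ < ⊤

end Lp

/-! ### Singular values of a diffeomorphism -/

/-- The singular values `α₁(x) ≥ ⋯ ≥ αₙ(x)` of `φ` at `x`, those of `T_x φ : T_x M → T_{φ x} N` for
the Riemannian inner products. The numbering starts at zero: `αᵢ(x)` is `singularValue n φ x (i-1)`,
and the entries from index `n` on are zero and never used. -/
def singularValue (n : ℕ) {M N : Type*}
    [TopologicalSpace M] [ChartedSpace (EuclideanSpace ℝ (Fin n)) M]
    [RiemannianBundle (fun x : M => TangentSpace (𝓡 n) x)]
    [TopologicalSpace N] [ChartedSpace (EuclideanSpace ℝ (Fin n)) N]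
    [RiemannianBundle (fun y : N => TangentSpace (𝓡 n) y)] (φ : M → N) (x : M) (i : ℕ) : ℝ :=
  (mfderiv (𝓡 n) (𝓡 n) φ x).toLinearMap.singularValues i

/-- The function `(α₁ ⋯ α_j)^s (α_{j+1} ⋯ αₙ)^t` on `M`. -/
def singularProduct (n : ℕ) {M N : Type*}
    [TopologicalSpace M] [ChartedSpace (EuclideanSpace ℝ (Fin n)) M]
    [RiemannianBundle (fun x : M => TangentSpace (𝓡 n) x)]
    [TopologicalSpace N] [ChartedSpace (EuclideanSpace ℝ (Fin n)) N]
    [RiemannianBundle (fun y : N => TangentSpace (𝓡 n) y)]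
    (φ : M → N) (j : ℕ) (s t : ℝ) (x : M) : ℝ :=
  (∏ i ∈ Finset.range j, singularValue n φ x i) ^ s *
    (∏ i ∈ Finset.Ico j n, singularValue n φ x i) ^ t

end RiemForms

end

/-!
The tangent map `T = T_x φ` has right singular vectors `b₁, …, bₙ`, and every `k`-dimensional
subspace of `T_x M` has an orthonormal basis `e₁, …, e_k` with `eᵢ ⟂ b₁, …, b_{i-1}`
(`exists_orthonormal_triangular`). For such a basis `|T eᵢ| ≤ αᵢ`. Up to a factor that Hadamard's
inequality controls, an alternating form takes the same value on any `k` vectors of the subspace as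
on the basis, so pulling back along `T` multiplies the pointwise spectral norm by `α₁ ⋯ α_k` at
most (`comass_compLinearMap_le`). Applied to `T` and to `T⁻¹`, whose singular values are the
inverses in reversed order, this gives

* `|ω|_x ≤ α₁ ⋯ α_k |φ_* ω|_{φ x}` (`spectralNorm_le_prod_mul_pushforward`),
* `|φ_* ω|_{φ x} ≤ (α_{n-k+1} ⋯ αₙ)⁻¹ |ω|_x` (`spectralNorm_pushforward_le`).

The second ingredient is the change of variables formula `μ_N = φ_* (J μ_M)` with the Jacobian
`J = α₁ ⋯ αₙ` (`riemannianMeasure_eq_map_withDensity_jacobian`). It is reduced to the change of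
variables formula of `ℝⁿ` by cutting `M` into countably many pieces, each inside the domain of a
chart and with image inside the domain of a chart of `N`. Since the two sides are cut
simultaneously, independence of the Riemannian measure from the choice of charts is not needed. The
formula turns `‖φ_* ω‖_p` into the `L^p` norm over `M` of `J^{1/p} |φ_* ω|_{φ x}`, and both bounds
follow on inserting the pointwise estimates and `1/p + 1/q = 1`. Spectral norms are never shown to
be measurable: the change of variables formula and the required form of Hölder's inequality hold for
the lower Lebesgue integral of arbitrary functions with values in `[0, ∞]`.
-/

namespace RiemForms

/-! ### Alternating forms on inner product spaces -/

section Comass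

open Module

variable {V W : Type*} [NormedAddCommGroup V] [InnerProductSpace ℝ V]
  [NormedAddCommGroup W] [InnerProductSpace ℝ W] {k n : ℕ}

/-- The comass of an alternating form `η` on an inner product space: the supremum of
`|η(X₁, …, X_k)| / (|X₁| ⋯ |X_k|)` over nonzero vectors, with values in `[0, ∞]`. -/
noncomputable def comass (η : V [⋀^Fin k]→ₗ[ℝ] ℝ) : ℝ≥0∞ :=
  ⨆ (X : Fin k → V) (_ : ∀ i, X i ≠ 0), ENNReal.ofReal (|η X| / ∏ i, ‖X i‖)

theorem ofReal_abs_le_comass (η : V [⋀^Fin k]→ₗ[ℝ] ℝ) (X : Fin k → V) :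
    ENNReal.ofReal |η X| ≤ comass η * ENNReal.ofReal (∏ i, ‖X i‖) := by
  by_cases hX : ∀ i, X i ≠ 0
  · have hpos : 0 < ∏ i, ‖X i‖ := Finset.prod_pos fun i _ => norm_pos_iff.2 (hX i)
    calc ENNReal.ofReal |η X|
        = ENNReal.ofReal (|η X| / ∏ i, ‖X i‖) * ENNReal.ofReal (∏ i, ‖X i‖) := by
          rw [← ENNReal.ofReal_mul (by positivity), div_mul_cancel₀ _ hpos.ne']
      _ ≤ _ := by
          gcongr
          exact le_iSup₂_of_le X hX le_rfl
  · push Not at hX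
    obtain ⟨i, hi⟩ := hX
    rw [η.map_coord_zero i hi]
    simp

/-- A `k`-dimensional subspace has an orthonormal basis whose `i`-th vector is orthogonal to the
first `i` members of any prescribed sequence of vectors: the last basis vector has to satisfy
`k - 1` linear conditions, and the others are found in its orthogonal complement. -/
theorem exists_orthonormal_triangular (b : ℕ → V) :
    ∀ (k : ℕ) (K : Submodule ℝ V), finrank ℝ K = k →
      ∃ e : Fin k → V, Orthonormal ℝ e ∧ (∀ i, e i ∈ K) ∧
        ∀ (i : Fin k) (j : ℕ), j < i → inner ℝ (b j) (e i) = 0 := by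
  intro k
  induction k with
  | zero => exact fun K _ => ⟨Fin.elim0, ⟨fun i => i.elim0, fun i => i.elim0⟩,
      fun i => i.elim0, fun i => i.elim0⟩
  | succ k ih =>
    intro K hK
    have : FiniteDimensional ℝ K := FiniteDimensional.of_finrank_eq_succ hK
    -- The `k` conditions on the last basis vector have a nonzero solution in `K`.
    let L : K →ₗ[ℝ] (Fin k → ℝ) :=
      LinearMap.pi fun j => (innerₗ V (b j)) ∘ₗ K.subtype
    have hL : LinearMap.ker L ≠ ⊥ := by
      apply LinearMap.ker_ne_bot_of_finrank_lt
      simp [hK]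
    obtain ⟨u, huL, hu0⟩ := Submodule.exists_mem_ne_zero_of_ne_bot hL
    have huV : (u : V) ≠ 0 := by simpa using hu0
    let f : V := (‖(u : V)‖)⁻¹ • (u : V)
    have hf1 : ‖f‖ = 1 := norm_smul_inv_norm (𝕜 := ℝ) huV
    have hfK : f ∈ K := K.smul_mem _ u.2
    have hfb : ∀ j < k, inner ℝ (b j) f = 0 := by
      intro j hj
      have : inner ℝ (b j) (u : V) = 0 := congrFun (LinearMap.mem_ker.1 huL) ⟨j, hj⟩
      simp [f, inner_smul_right, this]
    let K' : Submodule ℝ V := (ℝ ∙ f)ᗮ ⊓ K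
    have hK' : finrank ℝ K' = k := by
      have hle : (ℝ ∙ f) ≤ K := by simpa using hfK
      have h1 := Submodule.finrank_add_inf_finrank_orthogonal hle
      rw [finrank_span_singleton (by rintro h; simp [h] at hf1), hK] at h1
      simp only [K']
      omega
    obtain ⟨e, heo, heK, heb⟩ := ih K' hK'
    have hfe : ∀ i, inner ℝ f (e i) = 0 := fun i =>
      Submodule.mem_orthogonal_singleton_iff_inner_right.1 (heK i).1
    refine ⟨Fin.snoc e f, ⟨fun i => ?_, fun i j hij => ?_⟩, fun i => ?_, fun i j hj => ?_⟩
    · refine Fin.lastCases ?_ (fun i => ?_) i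
      · simpa using hf1
      · simpa using heo.1 i
    · revert hij
      refine Fin.lastCases ?_ (fun i => ?_) i <;> refine Fin.lastCases ?_ (fun j => ?_) j
      · simp
      · simpa using fun _ => hfe j
      · simpa using (real_inner_comm _ _).trans (hfe i)
      · intro hij
        simpa using heo.2 (fun h => hij (by rw [h]))
    · refine Fin.lastCases ?_ (fun i => ?_) i
      · simpa using hfK
      · simpa using (heK i).2
    · revert hj
      refine Fin.lastCases ?_ (fun i => ?_) i
      · simpa using hfb j
      · simpa using heb i j

/-- On a `k`-dimensional subspace all alternating `k`-forms are multiples of one another, and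
Hadamard's inequality bounds the factor relative to an orthonormal basis. -/
theorem exists_apply_eq_mul_apply_orthonormal {K : Submodule ℝ V} [FiniteDimensional ℝ K]
    (hK : finrank ℝ K = k) {e : Fin k → V} (he : Orthonormal ℝ e) (heK : ∀ i, e i ∈ K)
    {X : Fin k → V} (hX : ∀ i, X i ∈ K) :
    ∃ c : ℝ, |c| ≤ ∏ i, ‖X i‖ ∧ ∀ η : V [⋀^Fin k]→ₗ[ℝ] ℝ, η X = c * η e := by
  have : Fact (finrank ℝ K = k) := ⟨hK⟩
  let e' : Fin k → K := fun i => ⟨e i, heK i⟩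
  let X' : Fin k → K := fun i => ⟨X i, hX i⟩
  have he' : Orthonormal ℝ e' := ⟨fun i => he.1 i, fun i j hij => he.2 hij⟩
  have hsp : ⊤ ≤ Submodule.span ℝ (Set.range e') :=
    (he'.linearIndependent.span_eq_top_of_card_eq_finrank' (by simp [hK])).ge
  let E : OrthonormalBasis (Fin k) ℝ K := OrthonormalBasis.mk he' hsp
  refine ⟨E.toBasis.det X', ?_, fun η => ?_⟩
  · rw [← (E.toBasis.orientation).volumeForm_robust' E X']
    exact (E.toBasis.orientation).abs_volumeForm_apply_le X'
  · have h := congrArg (fun ζ => ζ X')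
      (AlternatingMap.eq_smul_basis_det E.toBasis (η.compLinearMap K.subtype))
    have hE : (E.toBasis : Fin k → K) = e' := by simp [E]
    have h1 : (η.compLinearMap K.subtype) X' = η X := rfl
    have h2 : (η.compLinearMap K.subtype) e' = η e := rfl
    simpa [hE, h1, h2, mul_comm] using h

/-- If `|T v|² = ∑ sᵢ² ⟨bᵢ, v⟩²` for an orthonormal system `b` and `s₁ ≥ s₂ ≥ ⋯ ≥ 0`, pulling back
along `T` multiplies the comass by `s₁ ⋯ s_k` at most. Given `X₁, …, X_k`, choose in their span an
orthonormal basis `e` with `eᵢ ⟂ b₁, …, b_{i-1}`; then `|T eᵢ| ≤ sᵢ`. -/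
theorem comass_compLinearMap_le (T : V →ₗ[ℝ] W) {b : Fin n → V} (hb : Orthonormal ℝ b)
    {s : ℕ → ℝ} (hs0 : ∀ i, 0 ≤ s i) (hs : ∀ i j, i ≤ j → j < n → s j ≤ s i)
    (hT : ∀ v, ‖T v‖ ^ 2 = ∑ i : Fin n, s i ^ 2 * inner ℝ (b i) v ^ 2)
    (η : W [⋀^Fin k]→ₗ[ℝ] ℝ) :
    comass (η.compLinearMap T) ≤ ENNReal.ofReal (∏ i ∈ Finset.range k, s i) * comass η := by
  refine iSup₂_le fun X hX => ?_
  -- Linearly dependent vectors span less than `k` dimensions, but the form vanishes on them.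
  by_cases hli : LinearIndependent ℝ X
  swap
  · rw [AlternatingMap.map_linearDependent _ _ hli]
    simp
  have hK : finrank ℝ (Submodule.span ℝ (Set.range X)) = k := by
    simpa using finrank_span_eq_card hli
  have := FiniteDimensional.span_of_finite ℝ (Set.finite_range X)
  obtain ⟨e, heo, heK, heb⟩ := exists_orthonormal_triangular
    (fun j => if h : j < n then b ⟨j, h⟩ else 0) k _ hK
  obtain ⟨c, hc, hcη⟩ := exists_apply_eq_mul_apply_orthonormal hK heo heK
    (X := X) (fun i => Submodule.subset_span ⟨i, rfl⟩)
  have hTe : ∀ i : Fin k, ‖T (e i)‖ ≤ s i := by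
    intro i
    refine le_of_sq_le_sq ?_ (hs0 i)
    rw [hT]
    calc ∑ j : Fin n, s j ^ 2 * inner ℝ (b j) (e i) ^ 2
        ≤ ∑ j : Fin n, s i ^ 2 * inner ℝ (b j) (e i) ^ 2 := by
          refine Finset.sum_le_sum fun j _ => ?_
          rcases lt_or_ge (j : ℕ) i with hij | hij
          · have := heb i j hij
            simp only [j.2, dite_true, Fin.eta] at this
            simp [this]
          · have h1 := hs i j hij j.2
            have h2 := hs0 j
            gcongr
      _ = s i ^ 2 * ∑ j : Fin n, ‖inner ℝ (b j) (e i)‖ ^ 2 := by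
          simp [Finset.mul_sum]
      _ ≤ s i ^ 2 * ‖e i‖ ^ 2 := by
          gcongr
          exact hb.sum_inner_products_le (e i)
      _ = s i ^ 2 := by simp [heo.1 i]
  have hpos : 0 < ∏ i, ‖X i‖ := Finset.prod_pos fun i _ => norm_pos_iff.2 (hX i)
  rw [hcη]
  calc ENNReal.ofReal (|c * (η.compLinearMap T) e| / ∏ i, ‖X i‖)
      ≤ ENNReal.ofReal |η (T ∘ e)| := by
        refine ENNReal.ofReal_le_ofReal ?_
        rw [div_le_iff₀ hpos, abs_mul, mul_comm]
        exact mul_le_mul_of_nonneg_left hc (abs_nonneg _)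
    _ ≤ comass η * ENNReal.ofReal (∏ i, ‖T (e i)‖) := ofReal_abs_le_comass η _
    _ ≤ comass η * ENNReal.ofReal (∏ i ∈ Finset.range k, s i) := by
        gcongr
        rw [← Fin.prod_univ_eq_prod_range]
        exact Finset.prod_le_prod (fun i _ => norm_nonneg _) fun i _ => hTe i
    _ = _ := mul_comm _ _

variable [FiniteDimensional ℝ V] [FiniteDimensional ℝ W]

/-- The right singular vectors `b` of a linear map `T`: the eigenvectors of `T* T`. -/
theorem exists_orthonormalBasis_inner_map (T : V →ₗ[ℝ] W) (hn : finrank ℝ V = n) :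
    ∃ b : OrthonormalBasis (Fin n) ℝ V, ∀ i v,
      inner ℝ (T (b i)) (T v) = T.singularValues i ^ 2 * inner ℝ (b i) v := by
  refine ⟨T.isSymmetric_adjoint_comp_self.eigenvectorBasis hn, fun i v => ?_⟩
  rw [← LinearMap.adjoint_inner_left, ← LinearMap.comp_apply,
    LinearMap.IsSymmetric.apply_eigenvectorBasis, T.sq_singularValues_fin hn]
  simp [inner_smul_left]

theorem comass_compLinearMap_le_prod_singularValues (T : V →ₗ[ℝ] W)
    (η : W [⋀^Fin k]→ₗ[ℝ] ℝ) :
    comass (η.compLinearMap T) ≤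
      ENNReal.ofReal (∏ i ∈ Finset.range k, T.singularValues i) * comass η := by
  obtain ⟨b, hb⟩ := exists_orthonormalBasis_inner_map T rfl
  refine comass_compLinearMap_le T b.orthonormal T.singularValues_nonneg
    (fun i j hij _ => T.singularValues_antitone hij) (fun v => ?_) η
  calc ‖T v‖ ^ 2 = inner ℝ (T (∑ i, inner ℝ (b i) v • b i)) (T v) := by
        rw [b.sum_repr', real_inner_self_eq_norm_sq]
    _ = _ := by
        simp only [map_sum, map_smul, sum_inner, real_inner_smul_left, hb]
        exact Finset.sum_congr rfl fun i _ => by ring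

/-- The singular values of the inverse of `T` are the inverses of those of `T` in reversed order:
pulling back along the inverse multiplies the comass by the inverse of the product of the `k`
smallest singular values of `T` at most. -/
theorem comass_compLinearMap_symm_le (T : V ≃ₗ[ℝ] W) (hn : finrank ℝ V = n) (hk : k ≤ n)
    (η : V [⋀^Fin k]→ₗ[ℝ] ℝ) :
    comass (η.compLinearMap T.symm.toLinearMap) ≤
      ENNReal.ofReal (∏ i ∈ Finset.Ico (n - k) n, T.toLinearMap.singularValues i)⁻¹ *
        comass η := by
  obtain ⟨b, hb⟩ := exists_orthonormalBasis_inner_map T.toLinearMap hn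
  set σ := T.toLinearMap.singularValues with hσ
  have hpos : ∀ i < n, 0 < σ i := by
    rw [← hn]
    exact T.toLinearMap.injective_iff_forall_lt_finrank_singularValues_pos.1 T.injective
  -- The right singular vectors of the inverse, ordered so that its singular values decrease.
  let b' : Fin n → W := fun i => (σ i.rev)⁻¹ • T (b i.rev)
  have hb'T : ∀ i v, inner ℝ (b' i) (T v) = σ i.rev * inner ℝ (b i.rev) v := by
    intro i v
    have h := hb i.rev v
    have h0 := (hpos i.rev i.rev.2).ne'
    simp only [LinearEquiv.coe_coe] at h
    simp only [b', real_inner_smul_left, h]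
    field_simp
  have hb' : Orthonormal ℝ b' := by
    rw [orthonormal_iff_ite]
    intro i j
    have h0 := (hpos i.rev i.rev.2).ne'
    rw [show b' j = (σ j.rev)⁻¹ • T (b j.rev) from rfl, real_inner_smul_right, hb'T,
      orthonormal_iff_ite.1 b.orthonormal]
    by_cases hij : i = j
    · subst hij
      rw [if_pos rfl, mul_one, inv_mul_cancel₀ h0, if_pos rfl]
    · simp [hij]
  have key := comass_compLinearMap_le T.symm.toLinearMap hb' (s := fun i => (σ (n - 1 - i))⁻¹)
    (fun i => inv_nonneg.2 (T.toLinearMap.singularValues_nonneg _))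
    (fun i j hij hj => inv_anti₀ (hpos _ (by omega))
      (T.toLinearMap.singularValues_antitone (by omega)))
    (fun w => by
      obtain ⟨v, rfl⟩ := T.surjective w
      rw [LinearEquiv.coe_coe, T.symm_apply_apply, ← b.sum_sq_norm_inner_right v,
        ← Equiv.sum_comp Fin.revPerm]
      refine Finset.sum_congr rfl fun i _ => ?_
      have h0 := (hpos i.rev i.rev.2).ne'
      have hi : n - 1 - (i : ℕ) = i.rev := by simp [Fin.val_rev]; omega
      rw [hb'T, hi]
      simp only [Fin.revPerm_apply, Real.norm_eq_abs, sq_abs]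
      field_simp) η
  convert key using 3
  rw [← Finset.prod_inv_distrib]
  refine Finset.prod_bij' (fun i _ => n - 1 - i) (fun i _ => n - 1 - i) ?_ ?_ ?_ ?_ ?_
  · intro i hi; simp only [Finset.mem_Ico, Finset.mem_range] at *; omega
  · intro i hi; simp only [Finset.mem_Ico, Finset.mem_range] at *; omega
  · intro i hi; simp only [Finset.mem_Ico] at *; omega
  · intro i hi; simp only [Finset.mem_range] at *; omega
  · intro i hi
    simp only [Finset.mem_Ico] at hi
    rw [show n - 1 - (n - 1 - i) = i by omega]

/-- A linear map multiplies the absolute value of the volume form by its Jacobian. -/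
theorem abs_volumeForm_map [Fact (finrank ℝ V = n)] [Fact (finrank ℝ W = n)]
    (oV : Orientation ℝ V (Fin n)) (oW : Orientation ℝ W (Fin n)) (T : V →ₗ[ℝ] W)
    (v : Fin n → V) :
    |oW.volumeForm (fun i => T (v i))| = T.normDet * |oV.volumeForm v| := by
  let bV : OrthonormalBasis (Fin n) ℝ V :=
    (stdOrthonormalBasis ℝ V).reindex (finCongr (Fact.out : finrank ℝ V = n))
  let bW : OrthonormalBasis (Fin n) ℝ W :=
    (stdOrthonormalBasis ℝ W).reindex (finCongr (Fact.out : finrank ℝ W = n))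
  rw [oW.volumeForm_robust' bW, oV.volumeForm_robust' bV,
    T.normDet_eq_norm_det_toMatrix bV bW, Real.norm_eq_abs, ← abs_mul]
  congr 1
  rw [Basis.det_apply, Basis.det_apply, ← Matrix.det_mul]
  congr 1
  ext i j
  exact (congrFun (LinearMap.toMatrix_mulVec_repr bV.toBasis bW.toBasis T (v j)) i).symm

/-- The volume of a parallelepiped in terms of its Gram matrix. -/
theorem abs_volumeForm_eq_sqrt_det_gram [Fact (finrank ℝ V = n)]
    (o : Orientation ℝ V (Fin n)) (v : Fin n → V) :
    |o.volumeForm v| = √(Matrix.gram ℝ v).det := by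
  let b : OrthonormalBasis (Fin n) ℝ V :=
    (stdOrthonormalBasis ℝ V).reindex (finCongr (Fact.out : finrank ℝ V = n))
  rw [o.volumeForm_robust' b, ← Real.sqrt_sq_eq_abs, Basis.det_apply]
  congr 1
  have : Matrix.gram ℝ v = (b.toBasis.toMatrix v).transpose * b.toBasis.toMatrix v := by
    ext i j
    rw [Matrix.gram_apply, ← b.sum_inner_mul_inner]
    simp [Matrix.mul_apply, Basis.toMatrix_apply, b.repr_apply_apply, real_inner_comm]
  rw [this, Matrix.det_mul, Matrix.det_transpose, sq]

end Comass

/-! ### Volume forms and Jacobians in charts -/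

section Volume

variable {n : ℕ} {M : Type*} [TopologicalSpace M]
  [ChartedSpace (EuclideanSpace ℝ (Fin n)) M] [IsManifold (𝓡 n) ∞ M]

theorem continuousOn_coordVector (c : M) (v : EuclideanSpace ℝ (Fin n)) :
    ContinuousOn (fun y => (⟨(chartAt (EuclideanSpace ℝ (Fin n)) c).symm y, coordVector c y v⟩ :
      TangentBundle (𝓡 n) M)) (chartAt (EuclideanSpace ℝ (Fin n)) c).target := by
  have h1 : ContMDiffOn (𝓡 n) (𝓡 n) 1 (chartAt (EuclideanSpace ℝ (Fin n)) c).symm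
      (chartAt (EuclideanSpace ℝ (Fin n)) c).target :=
    (contMDiffOn_chart_symm (I := 𝓡 n) (n := ∞)).of_le (by simp)
  have hopen := (chartAt (EuclideanSpace ℝ (Fin n)) c).open_target
  have h2 := h1.continuousOn_tangentMapWithin le_rfl hopen.uniqueMDiffOn
  have h3 : Continuous fun y : EuclideanSpace ℝ (Fin n) =>
      (⟨y, v⟩ : TangentBundle (𝓡 n) (EuclideanSpace ℝ (Fin n))) :=
    (tangentBundleModelSpaceHomeomorph (𝓡 n)).symm.continuous.comp
      (continuous_id.prodMk continuous_const)
  refine (h2.comp h3.continuousOn fun y hy => hy).congr fun y hy => ?_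
  simp only [Function.comp, tangentMapWithin, coordVector]
  rw [mfderivWithin_of_mem_nhds (hopen.mem_nhds hy)]
  rfl

theorem coordVector_injective (c : M) {y : EuclideanSpace ℝ (Fin n)}
    (hy : y ∈ (chartAt (EuclideanSpace ℝ (Fin n)) c).target) :
    Function.Injective (coordVector c y) :=
  (mdifferentiable_chart (I := 𝓡 n) c).symm.mfderiv_injective hy

variable [RiemannianBundle (fun x : M => TangentSpace (𝓡 n) x)]

theorem isContinuousRiemannianBundle_tangentSpace
    [h : IsContMDiffRiemannianBundle (𝓡 n) ∞ (EuclideanSpace ℝ (Fin n))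
      (fun x : M => TangentSpace (𝓡 n) x)] :
    IsContinuousRiemannianBundle (EuclideanSpace ℝ (Fin n))
      (fun x : M => TangentSpace (𝓡 n) x) := by
  obtain ⟨g, hg, hg'⟩ := h.exists_contMDiff
  exact ⟨g, hg.continuous, hg'⟩

/-- The volume spanned by vectors that depend continuously on a parameter, their base point
included, is continuous: it is the square root of the determinant of the Gram matrix. -/
theorem continuousOn_abs_volForm
    [IsContMDiffRiemannianBundle (𝓡 n) ∞ (EuclideanSpace ℝ (Fin n))
      (fun x : M => TangentSpace (𝓡 n) x)]
    (o : ManifoldOrientation n M) {Z : Type*} [TopologicalSpace Z] {s : Set Z} {b : Z → M}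
    {X : Fin n → ∀ z, TangentSpace (𝓡 n) (b z)}
    (hX : ∀ i, ContinuousOn (fun z => (⟨b z, X i z⟩ : TangentBundle (𝓡 n) M)) s) :
    ContinuousOn (fun z => |volForm o (b z) (fun i => X i z)|) s := by
  have := isContinuousRiemannianBundle_tangentSpace (n := n) (M := M)
  simp only [volForm, abs_volumeForm_eq_sqrt_det_gram]
  refine Real.continuous_sqrt.comp_continuousOn ?_
  have hdet : Continuous (Matrix.det : Matrix (Fin n) (Fin n) ℝ → ℝ) :=
    Continuous.matrix_det continuous_id
  refine hdet.comp_continuousOn (continuousOn_pi.2 fun i => continuousOn_pi.2 fun j => ?_)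
  exact ContinuousOn.inner_bundle (hX i) (hX j)

theorem abs_volForm_coordVector_pos (o : ManifoldOrientation n M) (c : M)
    {y : EuclideanSpace ℝ (Fin n)} (hy : y ∈ (chartAt (EuclideanSpace ℝ (Fin n)) c).target) :
    0 < |volForm o ((chartAt (EuclideanSpace ℝ (Fin n)) c).symm y)
      (fun i => coordVector c y (EuclideanSpace.single i 1))| := by
  have : Fact (Module.finrank ℝ (EuclideanSpace ℝ (Fin n)) = n) := ⟨finrank_euclideanSpace_fin⟩
  let b := EuclideanSpace.basisFun (Fin n) ℝ
  have h := abs_volumeForm_map b.toBasis.orientation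
    (o.orient ((chartAt (EuclideanSpace ℝ (Fin n)) c).symm y)) (coordVector c y) b
  rw [Orientation.abs_volumeForm_apply_of_orthonormal, mul_one] at h
  simp only [b, EuclideanSpace.basisFun_apply] at h
  rw [volForm, h]
  have h0 := (coordVector c y).normDet_ne_zero_tfae.out 0 4
  exact lt_of_le_of_ne (LinearMap.normDet_nonneg _) (h0.2 (coordVector_injective c hy)).symm

end Volume

/-- Functions of tangent vectors agree at points that are equal, not necessarily by definition, and
at tangent vectors that are equal as elements of `ℝⁿ`. -/
theorem apply_tangentSpace_congr {n : ℕ} {M : Type*} [TopologicalSpace M]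
    [ChartedSpace (EuclideanSpace ℝ (Fin n)) M] {α ι : Type*}
    (Φ : ∀ p : M, (ι → TangentSpace (𝓡 n) p) → α) {p p' : M} (h : p = p')
    {X : ι → TangentSpace (𝓡 n) p} {X' : ι → TangentSpace (𝓡 n) p'}
    (hX : ∀ i, (X i : EuclideanSpace ℝ (Fin n)) = X' i) : Φ p X = Φ p' X' := by
  subst h
  exact congrArg (Φ p) (funext hX)

section Transition

variable {n : ℕ} {M N : Type*}
  [TopologicalSpace M] [ChartedSpace (EuclideanSpace ℝ (Fin n)) M]
  [TopologicalSpace N] [ChartedSpace (EuclideanSpace ℝ (Fin n)) N]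

/-- The expression of `φ` in the preferred charts around `c` and `d`. -/
noncomputable def inCharts (φ : M → N) (c : M) (d : N) (y : EuclideanSpace ℝ (Fin n)) :
    EuclideanSpace ℝ (Fin n) :=
  chartAt (EuclideanSpace ℝ (Fin n)) d (φ ((chartAt (EuclideanSpace ℝ (Fin n)) c).symm y))

/-- The points of the target of the chart around `c` at which `inCharts φ c d` represents `φ`. -/
def inChartsDomain (φ : M → N) (c : M) (d : N) : Set (EuclideanSpace ℝ (Fin n)) :=
  (chartAt (EuclideanSpace ℝ (Fin n)) c).target ∩
    (fun y => φ ((chartAt (EuclideanSpace ℝ (Fin n)) c).symm y)) ⁻¹'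
      (chartAt (EuclideanSpace ℝ (Fin n)) d).source

theorem isOpen_inChartsDomain {φ : M → N} (hφ : Continuous φ) (c : M) (d : N) :
    IsOpen (inChartsDomain (n := n) φ c d) :=
  (hφ.comp_continuousOn
    (chartAt (EuclideanSpace ℝ (Fin n)) c).continuousOn_symm).isOpen_inter_preimage
    (chartAt (EuclideanSpace ℝ (Fin n)) c).open_target
    (chartAt (EuclideanSpace ℝ (Fin n)) d).open_source

theorem inCharts_symm_inCharts (φ : M ≃ₘ⟮𝓡 n, 𝓡 n⟯ N) {c : M} {d : N}
    {y : EuclideanSpace ℝ (Fin n)} (hy : y ∈ inChartsDomain φ c d) :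
    inCharts φ.symm d c (inCharts φ c d y) = y := by
  simp only [inCharts]
  rw [(chartAt (EuclideanSpace ℝ (Fin n)) d).left_inv hy.2, φ.symm_apply_apply,
    (chartAt (EuclideanSpace ℝ (Fin n)) c).right_inv hy.1]

theorem inCharts_mem_inChartsDomain_symm (φ : M ≃ₘ⟮𝓡 n, 𝓡 n⟯ N) {c : M} {d : N}
    {y : EuclideanSpace ℝ (Fin n)} (hy : y ∈ inChartsDomain φ c d) :
    inCharts φ c d y ∈ inChartsDomain φ.symm d c := by
  refine ⟨(chartAt (EuclideanSpace ℝ (Fin n)) d).map_source hy.2, ?_⟩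
  simp only [inCharts, Set.mem_preimage]
  rw [(chartAt (EuclideanSpace ℝ (Fin n)) d).left_inv hy.2, φ.symm_apply_apply]
  exact (chartAt (EuclideanSpace ℝ (Fin n)) c).map_target hy.1

variable [IsManifold (𝓡 n) ∞ M] [IsManifold (𝓡 n) ∞ N]

theorem mdifferentiableAt_inCharts {φ : M → N} (hφ : MDifferentiable (𝓡 n) (𝓡 n) φ)
    {c : M} {d : N} {y : EuclideanSpace ℝ (Fin n)} (hy : y ∈ inChartsDomain φ c d) :
    MDifferentiableAt (𝓡 n) (𝓡 n) (inCharts φ c d) y :=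
  ((mdifferentiable_chart (I := 𝓡 n) d).mdifferentiableAt hy.2).comp y
    ((hφ _).comp y ((mdifferentiable_chart (I := 𝓡 n) c).mdifferentiableAt_symm hy.1))

theorem differentiableAt_inCharts {φ : M → N} (hφ : MDifferentiable (𝓡 n) (𝓡 n) φ)
    {c : M} {d : N} {y : EuclideanSpace ℝ (Fin n)} (hy : y ∈ inChartsDomain φ c d) :
    DifferentiableAt ℝ (inCharts φ c d) y :=
  mdifferentiableAt_iff_differentiableAt.1 (mdifferentiableAt_inCharts hφ hy)

/-- The chain rule `T φ ∘ T c⁻¹ = T d⁻¹ ∘ D (d ∘ φ ∘ c⁻¹)`. The two sides take values in tangent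
spaces at points that are equal, but not by definition; so the equation is stated for an arbitrary
function `Φ` of finitely many tangent vectors at a point. -/
theorem apply_coordVector_fderiv_inCharts {α ι : Type*} {φ : M → N}
    (hφ : MDifferentiable (𝓡 n) (𝓡 n) φ) {c : M} {d : N} {y : EuclideanSpace ℝ (Fin n)}
    (hy : y ∈ inChartsDomain φ c d) (Φ : ∀ p : N, (ι → TangentSpace (𝓡 n) p) → α)
    (v : ι → EuclideanSpace ℝ (Fin n)) :
    Φ ((chartAt (EuclideanSpace ℝ (Fin n)) d).symm (inCharts φ c d y))
        (fun i => coordVector d (inCharts φ c d y) (fderiv ℝ (inCharts φ c d) y (v i))) =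
      Φ (φ ((chartAt (EuclideanSpace ℝ (Fin n)) c).symm y))
        (fun i => mfderiv (𝓡 n) (𝓡 n) φ ((chartAt (EuclideanSpace ℝ (Fin n)) c).symm y)
          (coordVector c y (v i))) := by
  have hF : inCharts φ c d y ∈ (chartAt (EuclideanSpace ℝ (Fin n)) d).target :=
    (chartAt (EuclideanSpace ℝ (Fin n)) d).map_source hy.2
  have h1 := mfderiv_comp (I := 𝓡 n) (I' := 𝓡 n) (I'' := 𝓡 n) y
    ((mdifferentiable_chart (I := 𝓡 n) d).mdifferentiableAt_symm hF)
    (mdifferentiableAt_inCharts hφ hy)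
  have h2 := mfderiv_comp (I := 𝓡 n) (I' := 𝓡 n) (I'' := 𝓡 n) y (hφ _)
    ((mdifferentiable_chart (I := 𝓡 n) c).mdifferentiableAt_symm hy.1)
  have heq : ((chartAt (EuclideanSpace ℝ (Fin n)) d).symm ∘ inCharts φ c d) =ᶠ[nhds y]
      (φ ∘ (chartAt (EuclideanSpace ℝ (Fin n)) c).symm) := by
    filter_upwards [(isOpen_inChartsDomain hφ.continuous c d).mem_nhds hy] with z hz
    exact (chartAt (EuclideanSpace ℝ (Fin n)) d).left_inv hz.2
  have h3 := heq.mfderiv_eq (I := 𝓡 n) (I' := 𝓡 n)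
  rw [mfderiv_eq_fderiv] at h1
  refine apply_tangentSpace_congr Φ ((chartAt (EuclideanSpace ℝ (Fin n)) d).left_inv hy.2)
    fun i => ?_
  exact congrArg (fun T : EuclideanSpace ℝ (Fin n) →L[ℝ] EuclideanSpace ℝ (Fin n) => T (v i))
    ((h1.symm.trans h3).trans h2)

end Transition

section Jacobian

variable {n : ℕ} {M N : Type*}
  [TopologicalSpace M] [ChartedSpace (EuclideanSpace ℝ (Fin n)) M]
  [RiemannianBundle (fun x : M => TangentSpace (𝓡 n) x)]
  [TopologicalSpace N] [ChartedSpace (EuclideanSpace ℝ (Fin n)) N]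
  [RiemannianBundle (fun y : N => TangentSpace (𝓡 n) y)]

/-- The Jacobian of a map between Riemannian manifolds: the factor by which its tangent maps
multiply volumes. -/
noncomputable def jacobian (n : ℕ) {M N : Type*}
    [TopologicalSpace M] [ChartedSpace (EuclideanSpace ℝ (Fin n)) M]
    [RiemannianBundle (fun x : M => TangentSpace (𝓡 n) x)]
    [TopologicalSpace N] [ChartedSpace (EuclideanSpace ℝ (Fin n)) N]
    [RiemannianBundle (fun y : N => TangentSpace (𝓡 n) y)] (φ : M → N) (x : M) : ℝ :=
  (mfderiv (𝓡 n) (𝓡 n) φ x).toLinearMap.normDet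

theorem jacobian_nonneg (φ : M → N) (x : M) : 0 ≤ jacobian n φ x :=
  LinearMap.normDet_nonneg _

theorem jacobian_eq_prod_singularValue (φ : M → N) (x : M) :
    jacobian n φ x = ∏ i ∈ Finset.range n, singularValue n φ x i := by
  have h := (mfderiv (𝓡 n) (𝓡 n) φ x).toLinearMap.normDet_eq_prod_singularValues
  rw [(Fact.out : Module.finrank ℝ (TangentSpace (𝓡 n) x) = n)] at h
  exact h

variable [IsManifold (𝓡 n) ∞ M] [IsManifold (𝓡 n) ∞ N]

theorem abs_volForm_mfderiv (oM : ManifoldOrientation n M) (oN : ManifoldOrientation n N)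
    (φ : M → N) (x : M) (v : Fin n → TangentSpace (𝓡 n) x) :
    |volForm oN (φ x) (fun i => mfderiv (𝓡 n) (𝓡 n) φ x (v i))| =
      jacobian n φ x * |volForm oM x v| :=
  abs_volumeForm_map (oM.orient x) (oN.orient (φ x)) _ v

/-- The change of volume densities in charts. -/
theorem abs_det_fderiv_inCharts_mul (oM : ManifoldOrientation n M) (oN : ManifoldOrientation n N)
    {φ : M → N} (hφ : MDifferentiable (𝓡 n) (𝓡 n) φ) {c : M} {d : N}
    {y : EuclideanSpace ℝ (Fin n)} (hy : y ∈ inChartsDomain φ c d) :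
    |(fderiv ℝ (inCharts φ c d) y).det| *
        |volForm oN ((chartAt (EuclideanSpace ℝ (Fin n)) d).symm (inCharts φ c d y))
          (fun i => coordVector d (inCharts φ c d y) (EuclideanSpace.single i 1))| =
      jacobian n φ ((chartAt (EuclideanSpace ℝ (Fin n)) c).symm y) *
        |volForm oM ((chartAt (EuclideanSpace ℝ (Fin n)) c).symm y)
          (fun i => coordVector c y (EuclideanSpace.single i 1))| := by
  rw [← abs_volForm_mfderiv oM oN,
    ← apply_coordVector_fderiv_inCharts hφ hy (fun p v => |volForm oN p v|), ← abs_mul]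
  congr 1
  let b := (EuclideanSpace.basisFun (Fin n) ℝ).toBasis
  let η : EuclideanSpace ℝ (Fin n) [⋀^Fin n]→ₗ[ℝ] ℝ :=
    (volForm oN ((chartAt (EuclideanSpace ℝ (Fin n)) d).symm (inCharts φ c d y))).compLinearMap
      (coordVector d (inCharts φ c d y))
  have h := congrArg (fun ζ => ζ ((fderiv ℝ (inCharts φ c d) y).toLinearMap ∘ b))
    (AlternatingMap.eq_smul_basis_det b η)
  simp only [AlternatingMap.smul_apply, Module.Basis.det_comp, Module.Basis.det_self,
    mul_one, smul_eq_mul] at h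
  have hb : ∀ i, b i = EuclideanSpace.single i 1 := fun i => by simp [b]
  have hη : η b = volForm oN ((chartAt (EuclideanSpace ℝ (Fin n)) d).symm (inCharts φ c d y))
      (fun i => coordVector d (inCharts φ c d y) (EuclideanSpace.single i 1)) := by
    simp only [← hb]
    rfl
  simp only [← hb] at hη ⊢
  rw [mul_comm, ← hη]
  exact h.symm

theorem continuous_jacobian
    [IsContMDiffRiemannianBundle (𝓡 n) ∞ (EuclideanSpace ℝ (Fin n))
      (fun x : M => TangentSpace (𝓡 n) x)]
    [IsContMDiffRiemannianBundle (𝓡 n) ∞ (EuclideanSpace ℝ (Fin n))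
      (fun y : N => TangentSpace (𝓡 n) y)]
    (oM : ManifoldOrientation n M) (oN : ManifoldOrientation n N)
    {φ : M → N} (hφ : ContMDiff (𝓡 n) (𝓡 n) ∞ φ) : Continuous (jacobian n φ) := by
  have htan : Continuous (tangentMap (𝓡 n) (𝓡 n) φ) := hφ.continuous_tangentMap (by simp)
  refine continuous_iff_continuousAt.2 fun c => ?_
  set e := chartAt (EuclideanSpace ℝ (Fin n)) c with he
  -- The Jacobian is the quotient of the volumes of the images of the coordinate vectors and of
  -- the coordinate vectors themselves.
  have h1 : ContinuousOn (fun y => |volForm oN (φ (e.symm y))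
      (fun i => mfderiv (𝓡 n) (𝓡 n) φ (e.symm y)
        (coordVector c y (EuclideanSpace.single i 1)))|) e.target :=
    continuousOn_abs_volForm oN (b := fun y => φ (e.symm y))
      (X := fun i y => mfderiv (𝓡 n) (𝓡 n) φ (e.symm y)
        (coordVector c y (EuclideanSpace.single i 1)))
      fun i => htan.comp_continuousOn (continuousOn_coordVector c (EuclideanSpace.single i 1))
  have h2 : ContinuousOn (fun y => |volForm oM (e.symm y)
      (fun i => coordVector c y (EuclideanSpace.single i 1))|) e.target :=
    continuousOn_abs_volForm oM fun i => continuousOn_coordVector c (EuclideanSpace.single i 1)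
  have h3 : ContinuousOn (fun y => jacobian n φ (e.symm y)) e.target := by
    refine (h1.div h2 fun y hy => (abs_volForm_coordVector_pos oM c hy).ne').congr fun y hy => ?_
    rw [Pi.div_apply, abs_volForm_mfderiv oM oN,
      mul_div_cancel_right₀ _ (abs_volForm_coordVector_pos oM c hy).ne']
  have h4 : ContinuousOn (jacobian n φ) e.source :=
    (h3.comp e.continuousOn e.mapsTo).congr fun x hx => by simp [e.left_inv hx]
  exact h4.continuousAt (chart_source_mem_nhds _ c)

end Jacobian

/-! ### Change of variables for the Riemannian measure -/

section ChartMeasure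

variable {n : ℕ} {M N : Type*}
  [TopologicalSpace M] [ChartedSpace (EuclideanSpace ℝ (Fin n)) M]
  [MeasurableSpace M] [BorelSpace M]
  [TopologicalSpace N] [ChartedSpace (EuclideanSpace ℝ (Fin n)) N]
  [MeasurableSpace N] [BorelSpace N]

theorem measurableSet_target_inter_preimage_symm (c : M) {A : Set M} (hA : MeasurableSet A) :
    MeasurableSet ((chartAt (EuclideanSpace ℝ (Fin n)) c).target ∩
      (chartAt (EuclideanSpace ℝ (Fin n)) c).symm ⁻¹' A) := by
  set e := chartAt (EuclideanSpace ℝ (Fin n)) c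
  have h : Continuous (e.target.domRestrict e.symm) :=
    continuousOn_iff_continuous_domRestrict.1 e.continuousOn_symm
  have h2 := e.open_target.measurableSet.subtype_image (h.measurable hA)
  convert h2 using 1
  ext y
  simp [Set.domRestrict, and_comm]

variable [IsManifold (𝓡 n) ∞ M] [RiemannianBundle (fun x : M => TangentSpace (𝓡 n) x)]
  [IsContMDiffRiemannianBundle (𝓡 n) ∞ (EuclideanSpace ℝ (Fin n))
    (fun x : M => TangentSpace (𝓡 n) x)]
  [IsManifold (𝓡 n) ∞ N] [RiemannianBundle (fun y : N => TangentSpace (𝓡 n) y)]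
  [IsContMDiffRiemannianBundle (𝓡 n) ∞ (EuclideanSpace ℝ (Fin n))
    (fun y : N => TangentSpace (𝓡 n) y)]

theorem setLIntegral_chartMeasure (o : ManifoldOrientation n M) (c : M) {A : Set M}
    (hA : MeasurableSet A) {f : M → ℝ≥0∞} (hf : Measurable f) :
    ∫⁻ x in A, f x ∂(chartMeasure o c) =
      ∫⁻ y in (chartAt (EuclideanSpace ℝ (Fin n)) c).target ∩
          (chartAt (EuclideanSpace ℝ (Fin n)) c).symm ⁻¹' A,
        ENNReal.ofReal |volForm o ((chartAt (EuclideanSpace ℝ (Fin n)) c).symm y)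
            (fun i => coordVector c y (EuclideanSpace.single i 1))| *
          f ((chartAt (EuclideanSpace ℝ (Fin n)) c).symm y) := by
  set e := chartAt (EuclideanSpace ℝ (Fin n)) c with he
  have ht : MeasurableSet e.target := e.open_target.measurableSet
  have hρ : AEMeasurable (fun y => ENNReal.ofReal |volForm o (e.symm y)
      (fun i => coordVector c y (EuclideanSpace.single i 1))|) (volume.restrict e.target) :=
    ((continuousOn_abs_volForm o fun i =>
      continuousOn_coordVector c (EuclideanSpace.single i 1)).aemeasurable ht).ennreal_ofReal
  have hsymm : AEMeasurable e.symm (volume.restrict e.target) :=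
    e.continuousOn_symm.aemeasurable ht
  rw [← lintegral_indicator hA, chartMeasure,
    lintegral_map' (hf.indicator hA).aemeasurable
      (hsymm.mono_ac (withDensity_absolutelyContinuous _ _)),
    lintegral_withDensity_eq_lintegral_mul_non_measurable₀ _ hρ (by simp),
    ← lintegral_indicator ht,
    ← lintegral_indicator (measurableSet_target_inter_preimage_symm c hA)]
  refine lintegral_congr fun y => ?_
  by_cases h1 : y ∈ e.target <;> by_cases h2 : e.symm y ∈ A <;> simp [← he, h1, h2]

theorem chartMeasure_apply (o : ManifoldOrientation n M) (c : M) {A : Set M}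
    (hA : MeasurableSet A) :
    chartMeasure o c A =
      ∫⁻ y in (chartAt (EuclideanSpace ℝ (Fin n)) c).target ∩
          (chartAt (EuclideanSpace ℝ (Fin n)) c).symm ⁻¹' A,
        ENNReal.ofReal |volForm o ((chartAt (EuclideanSpace ℝ (Fin n)) c).symm y)
            (fun i => coordVector c y (EuclideanSpace.single i 1))| := by
  simpa using setLIntegral_chartMeasure o c hA (f := fun _ => 1) measurable_const

/-- The change of variables formula for a set that lies in one chart and whose image lies in one
chart. -/
theorem chartMeasure_image (oM : ManifoldOrientation n M) (oN : ManifoldOrientation n N)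
    (φ : M ≃ₘ⟮𝓡 n, 𝓡 n⟯ N) {c : M} {d : N} {A : Set M} (hA : MeasurableSet A)
    (hAc : A ⊆ (chartAt (EuclideanSpace ℝ (Fin n)) c).source)
    (hAd : A ⊆ φ ⁻¹' (chartAt (EuclideanSpace ℝ (Fin n)) d).source) :
    chartMeasure oN d (φ '' A) =
      ∫⁻ x in A, ENNReal.ofReal (jacobian n φ x) ∂(chartMeasure oM c) := by
  have hφ : MDifferentiable (𝓡 n) (𝓡 n) φ := φ.mdifferentiable (by simp)
  have hJ : Measurable fun x => ENNReal.ofReal (jacobian n φ x) :=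
    (continuous_jacobian oM oN φ.contMDiff).measurable.ennreal_ofReal
  have hφA : MeasurableSet (φ '' A) := φ.toHomeomorph.toMeasurableEquiv.measurableSet_image.2 hA
  rw [chartMeasure_apply oN d hφA, setLIntegral_chartMeasure oM c hA hJ]
  set e := chartAt (EuclideanSpace ℝ (Fin n)) c with he
  set e' := chartAt (EuclideanSpace ℝ (Fin n)) d with he'
  have hB := measurableSet_target_inter_preimage_symm (n := n) c hA
  rw [← he] at hB
  have hdom : e.target ∩ e.symm ⁻¹' A ⊆ inChartsDomain φ c d := fun y hy => ⟨hy.1, hAd hy.2⟩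
  -- The image of `A` read in the chart around `d` is the image under `d ∘ φ ∘ c⁻¹` of `A` read in
  -- the chart around `c`.
  have himg : e'.target ∩ e'.symm ⁻¹' (φ '' A) = inCharts φ c d '' (e.target ∩ e.symm ⁻¹' A) := by
    ext z
    constructor
    · rintro ⟨hz, x, hx, hxz⟩
      refine ⟨e x, ⟨e.map_source (hAc hx), ?_⟩, ?_⟩
      · simpa [e.left_inv (hAc hx)] using hx
      · simp only [inCharts, ← he, ← he']
        rw [e.left_inv (hAc hx), hxz, e'.right_inv hz]
    · rintro ⟨y, hy, rfl⟩
      refine ⟨e'.map_source (hAd hy.2), e.symm y, hy.2, ?_⟩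
      exact (e'.left_inv (hAd hy.2)).symm
  rw [himg, lintegral_image_eq_lintegral_abs_det_fderiv_mul volume hB
    (fun y hy => (differentiableAt_inCharts hφ (hdom hy)).hasFDerivAt.hasFDerivWithinAt)
    (Set.LeftInvOn.injOn (f₁' := inCharts φ.symm d c) ?_)]
  · refine setLIntegral_congr_fun hB fun y hy => ?_
    have h := abs_det_fderiv_inCharts_mul oM oN hφ (hdom hy)
    simp only [← he] at h
    rw [← ENNReal.ofReal_mul (abs_nonneg _), h, ENNReal.ofReal_mul (jacobian_nonneg _ _), mul_comm]
  · exact fun y hy => inCharts_symm_inCharts φ (hdom hy)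

end ChartMeasure

section RiemannianMeasure

variable {n : ℕ} {M N : Type*}
  [TopologicalSpace M] [SecondCountableTopology M]
  [ChartedSpace (EuclideanSpace ℝ (Fin n)) M] [IsManifold (𝓡 n) ∞ M]
  [MeasurableSpace M] [BorelSpace M]
  [RiemannianBundle (fun x : M => TangentSpace (𝓡 n) x)]
  [IsContMDiffRiemannianBundle (𝓡 n) ∞ (EuclideanSpace ℝ (Fin n))
    (fun x : M => TangentSpace (𝓡 n) x)]
  [TopologicalSpace N] [SecondCountableTopology N]
  [ChartedSpace (EuclideanSpace ℝ (Fin n)) N] [IsManifold (𝓡 n) ∞ N]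
  [MeasurableSpace N] [BorelSpace N]
  [RiemannianBundle (fun y : N => TangentSpace (𝓡 n) y)]
  [IsContMDiffRiemannianBundle (𝓡 n) ∞ (EuclideanSpace ℝ (Fin n))
    (fun y : N => TangentSpace (𝓡 n) y)]

/-- The change of variables formula. The pieces into which the two Riemannian measures are cut are
refined to pieces of `M` lying in one chart whose image lies in one chart of `N`. -/
theorem riemannianMeasure_eq_map_withDensity_jacobian
    (oM : ManifoldOrientation n M) (oN : ManifoldOrientation n N) (φ : M ≃ₘ⟮𝓡 n, 𝓡 n⟯ N) :
    riemannianMeasure oN = Measure.map φ ((riemannianMeasure oM).withDensity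
      fun x => ENNReal.ofReal (jacobian n φ x)) := by
  obtain ⟨hcM, hmM, hsM⟩ := (exists_chartSelector n M).choose_spec
  obtain ⟨hcN, hmN, hsN⟩ := (exists_chartSelector n N).choose_spec
  change (Set.range (chartSelector n M)).Countable at hcM
  change (Set.range (chartSelector n N)).Countable at hcN
  change ∀ c, MeasurableSet (chartSelector n M ⁻¹' {c}) at hmM
  change ∀ c, MeasurableSet (chartSelector n N ⁻¹' {c}) at hmN
  change ∀ x, x ∈ (chartAt (EuclideanSpace ℝ (Fin n)) (chartSelector n M x)).source at hsM
  change ∀ x, x ∈ (chartAt (EuclideanSpace ℝ (Fin n)) (chartSelector n N x)).source at hsN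
  set κM := chartSelector n M with hκM
  set κN := chartSelector n N with hκN
  have := hcM.to_subtype
  have := hcN.to_subtype
  have hφm : Measurable φ := φ.continuous.measurable
  refine Measure.ext fun S hS => ?_
  have hS' : MeasurableSet (φ ⁻¹' S) := hφm hS
  let piece : Set.range κM → Set.range κN → Set M := fun c d =>
    φ ⁻¹' S ∩ κM ⁻¹' {c.1} ∩ φ ⁻¹' (κN ⁻¹' {d.1})
  have hpm : ∀ c d, MeasurableSet (piece c d) := fun c d =>
    (hS'.inter (hmM _)).inter (hφm (hmN _))
  have hpiece : ∀ c d, chartMeasure oN d.1 (φ '' piece c d) =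
      ∫⁻ x in piece c d, ENNReal.ofReal (jacobian n φ x) ∂(chartMeasure oM c.1) := by
    intro c d
    refine chartMeasure_image oM oN φ (hpm c d) (fun x hx => ?_) (fun x hx => ?_)
    · have h1 : κM x = c.1 := hx.1.2
      rw [← h1]
      exact hsM x
    · have h1 : κN (φ x) = d.1 := hx.2
      rw [← h1]
      exact hsN (φ x)
  have hN : riemannianMeasure oN S = ∑' d, ∑' c, chartMeasure oN d.1 (φ '' piece c d) := by
    rw [riemannianMeasure, Measure.sum_apply _ hS]
    refine tsum_congr fun d => ?_
    rw [Measure.restrict_apply hS, ← measure_iUnion]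
    · congr 1
      ext y
      simp only [Set.mem_inter_iff, Set.mem_iUnion, Set.mem_image, piece]
      constructor
      · intro hy
        exact ⟨⟨κM (φ.symm y), _, rfl⟩, φ.symm y, by simpa using hy, by simp⟩
      · rintro ⟨c, x, hx, rfl⟩
        exact ⟨hx.1.1, hx.2⟩
    · intro c c' hcc
      refine Set.disjoint_left.2 ?_
      rintro _ ⟨x, hx, rfl⟩ ⟨x', hx', hxx⟩
      obtain rfl := φ.injective hxx
      exact hcc (Subtype.ext (hx.1.2.symm.trans hx'.1.2))
    · exact fun c => φ.toHomeomorph.toMeasurableEquiv.measurableSet_image.2 (hpm c d)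
  have hM : Measure.map φ ((riemannianMeasure oM).withDensity
      fun x => ENNReal.ofReal (jacobian n φ x)) S = ∑' c, ∑' d,
        ∫⁻ x in piece c d, ENNReal.ofReal (jacobian n φ x) ∂(chartMeasure oM c.1) := by
    rw [Measure.map_apply hφm hS, withDensity_apply _ hS', riemannianMeasure,
      Measure.restrict_sum _ hS', lintegral_sum_measure]
    refine tsum_congr fun c => ?_
    rw [Measure.restrict_restrict hS', ← lintegral_iUnion (hpm c)]
    · congr 2
      ext x
      simp only [Set.mem_inter_iff, Set.mem_iUnion, piece]
      constructor
      · intro hx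
        exact ⟨⟨κN (φ x), _, rfl⟩, hx, rfl⟩
      · rintro ⟨d, hx⟩
        exact hx.1
    · intro d d' hdd
      refine Set.disjoint_left.2 fun x hx hx' => ?_
      exact hdd (Subtype.ext (hx.2.symm.trans hx'.2))
  rw [hN, hM, ENNReal.tsum_comm]
  exact tsum_congr fun c => tsum_congr fun d => hpiece c d

end RiemannianMeasure

/-! ### Measurability of the pushforward -/

section Measurability

variable {n k : ℕ} {M N : Type*}
  [TopologicalSpace M] [ChartedSpace (EuclideanSpace ℝ (Fin n)) M] [IsManifold (𝓡 n) ∞ M]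
  [TopologicalSpace N] [ChartedSpace (EuclideanSpace ℝ (Fin n)) N] [IsManifold (𝓡 n) ∞ N]

/-- The expression of a diffeomorphism in charts pulls Lebesgue null sets back to null sets. -/
theorem map_inCharts_absolutelyContinuous (φ : M ≃ₘ⟮𝓡 n, 𝓡 n⟯ N) (c : M) (d : N) :
    Measure.map (inCharts φ c d) (volume.restrict (inChartsDomain φ c d)) ≪
      volume.restrict (chartAt (EuclideanSpace ℝ (Fin n)) d).target := by
  have hφ : MDifferentiable (𝓡 n) (𝓡 n) φ := φ.mdifferentiable (by simp)
  have hφ' : MDifferentiable (𝓡 n) (𝓡 n) φ.symm := φ.symm.mdifferentiable (by simp)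
  have hU : MeasurableSet (inChartsDomain φ c d) :=
    (isOpen_inChartsDomain (n := n) φ.continuous c d).measurableSet
  have hF : AEMeasurable (inCharts φ c d) (volume.restrict (inChartsDomain φ c d)) :=
    ContinuousOn.aemeasurable (fun y hy =>
      (differentiableAt_inCharts hφ hy).continuousAt.continuousWithinAt) hU
  refine Measure.AbsolutelyContinuous.mk fun S hS hS0 => ?_
  rw [Measure.restrict_apply hS] at hS0
  rw [Measure.map_apply_of_aemeasurable hF hS, Measure.restrict_apply' hU]
  have hsub : inCharts φ c d ⁻¹' S ∩ inChartsDomain φ c d ⊆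
      inCharts φ.symm d c '' (S ∩ inChartsDomain φ.symm d c) := fun y hy =>
    ⟨inCharts φ c d y, ⟨hy.1, inCharts_mem_inChartsDomain_symm φ hy.2⟩,
      inCharts_symm_inCharts φ hy.2⟩
  refine measure_mono_null hsub ?_
  refine addHaar_image_eq_zero_of_differentiableOn_of_addHaar_eq_zero volume
    (fun y hy => (differentiableAt_inCharts hφ' hy.2).differentiableWithinAt) ?_
  exact measure_mono_null (Set.inter_subset_inter_right S Set.inter_subset_left) hS0

/-- Pullbacks of almost everywhere measurable forms by diffeomorphisms are almost everywhere
measurable: where the diffeomorphism is expressed in charts as `F`, the coefficients of the pullback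
are polynomials in the first derivatives of `F` and the coefficients of the form composed with `F`.
-/
theorem IsAEMeasurableForm.pullback [SecondCountableTopology N] (φ : M ≃ₘ⟮𝓡 n, 𝓡 n⟯ N)
    {η : KForm n k N} (hη : IsAEMeasurableForm η) : IsAEMeasurableForm (RiemForms.pullback φ η) := by
  have hφ : MDifferentiable (𝓡 n) (𝓡 n) φ := φ.mdifferentiable (by simp)
  intro c v
  set e := chartAt (EuclideanSpace ℝ (Fin n)) c with he
  obtain ⟨t, htc, htU⟩ := TopologicalSpace.countable_cover_nhds
    (f := fun y : N => (chartAt (EuclideanSpace ℝ (Fin n)) y).source)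
    (fun y => chart_source_mem_nhds _ y)
  have := htc.to_subtype
  have hcov : e.target = ⋃ d : t, inChartsDomain φ c d.1 := by
    ext y
    simp only [Set.mem_iUnion]
    constructor
    · intro hy
      have h : φ (e.symm y) ∈ ⋃ d ∈ t, (chartAt (EuclideanSpace ℝ (Fin n)) d).source :=
        htU ▸ Set.mem_univ _
      simp only [Set.mem_iUnion] at h
      obtain ⟨d, hd, hyd⟩ := h
      exact ⟨⟨d, hd⟩, hy, hyd⟩
    · rintro ⟨d, hd⟩
      exact hd.1
  rw [hcov, aemeasurable_iUnion_iff]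
  rintro ⟨d, -⟩
  set e' := chartAt (EuclideanSpace ℝ (Fin n)) d with he'
  set F := inCharts (n := n) φ c d with hFdef
  set U := inChartsDomain (n := n) φ c d with hUdef
  have hU : MeasurableSet U := (isOpen_inChartsDomain (n := n) φ.continuous c d).measurableSet
  have hF : AEMeasurable F (volume.restrict U) :=
    ContinuousOn.aemeasurable (fun y hy =>
      (differentiableAt_inCharts hφ hy).continuousAt.continuousWithinAt) hU
  -- The coefficients of `η` in the chart around `d`.
  let a : (Fin k → Fin n) → EuclideanSpace ℝ (Fin n) → ℝ := fun r z =>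
    η (e'.symm z) (fun i => coordVector d z (EuclideanSpace.single (r i) 1))
  have ha : ∀ r, AEMeasurable (fun y => a r (F y)) (volume.restrict U) := fun r =>
    ((hη d fun i => EuclideanSpace.single (r i) 1).mono_ac
      (map_inCharts_absolutelyContinuous φ c d)).comp_aemeasurable hF
  have hD : ∀ w, Measurable fun y => fderiv ℝ F y w := fun w => measurable_fderiv_apply_const ℝ F w
  have hsum : AEMeasurable (fun y => ∑ r : Fin k → Fin n,
      (∏ i, fderiv ℝ F y (v i) (r i)) * a r (F y)) (volume.restrict U) := by
    refine Finset.aemeasurable_fun_sum _ fun r _ => AEMeasurable.mul ?_ (ha r)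
    refine Finset.aemeasurable_fun_prod _ fun i _ => ?_
    have hproj : Measurable fun w : EuclideanSpace ℝ (Fin n) => w (r i) := by fun_prop
    exact (hproj.comp (hD (v i))).aemeasurable
  refine hsum.congr ?_
  filter_upwards [ae_restrict_mem hU] with y hy
  have hchain := apply_coordVector_fderiv_inCharts hφ hy (fun p w => η p w) v
  refine Eq.trans ?_ hchain
  have hexp : ∀ i, fderiv ℝ F y (v i) =
      ∑ j, (fderiv ℝ F y (v i) j) • EuclideanSpace.single j (1 : ℝ) := by
    intro i
    have := (EuclideanSpace.basisFun (Fin n) ℝ).sum_repr (fderiv ℝ F y (v i))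
    simpa using this.symm
  let ζ : MultilinearMap ℝ (fun _ : Fin k => EuclideanSpace ℝ (Fin n)) ℝ :=
    ((η (e'.symm (F y))).compLinearMap (coordVector d (F y))).toMultilinearMap
  have h1 : ζ (fun i => ∑ j, (fderiv ℝ F y (v i) j) • EuclideanSpace.single j (1 : ℝ)) =
      ∑ r : Fin k → Fin n, (∏ i, fderiv ℝ F y (v i) (r i)) * a r (F y) := by
    rw [MultilinearMap.map_sum]
    refine Finset.sum_congr rfl fun r _ => ?_
    rw [MultilinearMap.map_smul_univ]
    rfl
  rw [← h1]
  simp only [← hexp]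
  rfl

end Measurability

/-! ### Pointwise estimates for the pushforward -/

section Pointwise

variable {n k : ℕ} {M N : Type*}
  [TopologicalSpace M] [ChartedSpace (EuclideanSpace ℝ (Fin n)) M]
  [TopologicalSpace N] [ChartedSpace (EuclideanSpace ℝ (Fin n)) N]

theorem pullback_pushforward (φ : M ≃ₘ⟮𝓡 n, 𝓡 n⟯ N) (θ : KForm n k M) :
    pullback φ (pushforward φ θ) = θ := by
  funext x
  ext X
  have hcomp := mfderiv_comp (I := 𝓡 n) (I' := 𝓡 n) (I'' := 𝓡 n) x
    (φ.symm.mdifferentiable (by simp) (φ x)) (φ.mdifferentiable (by simp) x)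
  have hid : mfderiv (𝓡 n) (𝓡 n) (φ.symm ∘ φ) x = ContinuousLinearMap.id ℝ _ := by
    rw [show φ.symm ∘ φ = id from funext φ.symm_apply_apply]
    exact mfderiv_id
  refine apply_tangentSpace_congr (fun p v => θ p v) (φ.symm_apply_apply x) fun i => ?_
  exact congrArg (fun T : EuclideanSpace ℝ (Fin n) →L[ℝ] EuclideanSpace ℝ (Fin n) => T (X i))
    (hcomp.symm.trans hid)

variable [RiemannianBundle (fun x : M => TangentSpace (𝓡 n) x)]
  [RiemannianBundle (fun y : N => TangentSpace (𝓡 n) y)]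

theorem singularValue_pos (φ : M ≃ₘ⟮𝓡 n, 𝓡 n⟯ N) (x : M) {i : ℕ} (hi : i < n) :
    0 < singularValue n φ x i := by
  refine (LinearMap.injective_iff_forall_lt_finrank_singularValues_pos _).1 ?_ i
    (hi.trans_eq (Fact.out : Module.finrank ℝ (TangentSpace (𝓡 n) x) = n).symm)
  exact (φ.mfderivToContinuousLinearEquiv (by simp) x).injective

theorem spectralNorm_le_prod_mul_pushforward (φ : M ≃ₘ⟮𝓡 n, 𝓡 n⟯ N) (θ : KForm n k M) (x : M) :
    spectralNorm θ x ≤ ENNReal.ofReal (∏ i ∈ Finset.range k, singularValue n φ x i) *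
      spectralNorm (pushforward φ θ) (φ x) := by
  have h := comass_compLinearMap_le_prod_singularValues
    (mfderiv (𝓡 n) (𝓡 n) φ x).toLinearMap (pushforward φ θ (φ x))
  rw [show (pushforward φ θ (φ x)).compLinearMap (mfderiv (𝓡 n) (𝓡 n) φ x).toLinearMap = θ x from
    congrFun (pullback_pushforward φ θ) x] at h
  exact h

theorem spectralNorm_pushforward_le (φ : M ≃ₘ⟮𝓡 n, 𝓡 n⟯ N) (hk : k ≤ n) (θ : KForm n k M)
    (x : M) :
    spectralNorm (pushforward φ θ) (φ x) ≤
      ENNReal.ofReal (∏ i ∈ Finset.Ico (n - k) n, singularValue n φ x i)⁻¹ * spectralNorm θ x := by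
  let T : TangentSpace (𝓡 n) x ≃ₗ[ℝ] TangentSpace (𝓡 n) (φ x) :=
    (φ.mfderivToContinuousLinearEquiv (by simp) x).toLinearEquiv
  have h := comass_compLinearMap_symm_le T Fact.out hk (θ x)
  have hθ : θ x = (pushforward φ θ (φ x)).compLinearMap T.toLinearMap :=
    (congrFun (pullback_pushforward φ θ) x).symm
  have hT : (θ x).compLinearMap T.symm.toLinearMap = pushforward φ θ (φ x) := by
    rw [hθ]
    ext X
    simp
  rw [hT] at h
  exact h

theorem jacobian_pos (φ : M ≃ₘ⟮𝓡 n, 𝓡 n⟯ N) (x : M) : 0 < jacobian n φ x := by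
  rw [jacobian_eq_prod_singularValue]
  exact Finset.prod_pos fun i hi => singularValue_pos φ x (Finset.mem_range.1 hi)

theorem singularProduct_nonneg (φ : M ≃ₘ⟮𝓡 n, 𝓡 n⟯ N) {j : ℕ} (hj : j ≤ n) (s t : ℝ) (x : M) :
    0 ≤ singularProduct n φ j s t x :=
  mul_nonneg
    (Real.rpow_nonneg (Finset.prod_nonneg fun _ hi =>
      (singularValue_pos φ x ((Finset.mem_range.1 hi).trans_le hj)).le) _)
    (Real.rpow_nonneg (Finset.prod_nonneg fun _ hi =>
      (singularValue_pos φ x (Finset.mem_Ico.1 hi).2).le) _)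

/-- `(α₁ ⋯ αₙ)^s = (α₁ ⋯ α_j)^s (α_{j+1} ⋯ αₙ)^(-t) · (α_{j+1} ⋯ αₙ)` for `s + t = 1`. -/
theorem jacobian_rpow_eq_singularProduct_mul (φ : M ≃ₘ⟮𝓡 n, 𝓡 n⟯ N) {j : ℕ} (hj : j ≤ n)
    {s t : ℝ} (hst : s + t = 1) (x : M) :
    jacobian n φ x ^ s =
      singularProduct n φ j s (-t) x * ∏ i ∈ Finset.Ico j n, singularValue n φ x i := by
  have hA : 0 ≤ ∏ i ∈ Finset.range j, singularValue n φ x i := Finset.prod_nonneg fun _ hi =>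
    (singularValue_pos φ x ((Finset.mem_range.1 hi).trans_le hj)).le
  have hB : 0 < ∏ i ∈ Finset.Ico j n, singularValue n φ x i := Finset.prod_pos fun _ hi =>
    singularValue_pos φ x (Finset.mem_Ico.1 hi).2
  rw [jacobian_eq_prod_singularValue, ← Finset.prod_range_mul_prod_Ico _ hj,
    Real.mul_rpow hA hB.le, singularProduct, mul_assoc, ← Real.rpow_add_one hB.ne']
  congr 2
  linarith

/-- `α₁ ⋯ α_j = (α₁ ⋯ α_j)^t (α_{j+1} ⋯ αₙ)^(-s) · (α₁ ⋯ αₙ)^s` for `s + t = 1`. -/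
theorem prod_singularValue_eq_singularProduct_mul (φ : M ≃ₘ⟮𝓡 n, 𝓡 n⟯ N) {j : ℕ} (hj : j ≤ n)
    {s t : ℝ} (hst : s + t = 1) (x : M) :
    ∏ i ∈ Finset.range j, singularValue n φ x i =
      singularProduct n φ j t (-s) x * jacobian n φ x ^ s := by
  have hA : 0 < ∏ i ∈ Finset.range j, singularValue n φ x i := Finset.prod_pos fun _ hi =>
    singularValue_pos φ x ((Finset.mem_range.1 hi).trans_le hj)
  have hB : 0 < ∏ i ∈ Finset.Ico j n, singularValue n φ x i := Finset.prod_pos fun _ hi =>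
    singularValue_pos φ x (Finset.mem_Ico.1 hi).2
  rw [jacobian_eq_prod_singularValue, ← Finset.prod_range_mul_prod_Ico _ hj,
    Real.mul_rpow hA.le hB.le, singularProduct, mul_mul_mul_comm, ← Real.rpow_add hA,
    ← Real.rpow_add hB, add_comm t s, hst]
  simp

end Pointwise

/-! ### `L^p` estimates for the pushforward -/

/-- An `L^∞`-`L^p` Hölder inequality without measurability assumptions. -/
theorem eLpNorm_le_eLpNorm_top_mul {α : Type*} {m : MeasurableSpace α} {μ : Measure α}
    {f g : α → ℝ≥0∞} {S : α → ℝ} (hS : ∀ x, 0 ≤ S x)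
    (h : ∀ x, f x ≤ ENNReal.ofReal (S x) * g x) (hfin : eLpNorm S ⊤ μ ≠ ⊤) (p : ℝ≥0∞) :
    eLpNorm f p μ ≤ eLpNorm S ⊤ μ * eLpNorm g p μ := by
  have hae : ∀ᵐ x ∂μ, ‖f x‖ₑ ≤ (eLpNorm S ⊤ μ).toNNReal * ‖g x‖ₑ := by
    rw [ENNReal.coe_toNNReal hfin, eLpNorm_exponent_top]
    filter_upwards [enorm_ae_le_eLpNormEssSup S μ] with x hx
    rw [Real.enorm_of_nonneg (hS x)] at hx
    exact (h x).trans (by gcongr; rfl)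
  have := eLpNorm_le_mul_eLpNorm_of_ae_le_mul' hae p
  rwa [ENNReal.coe_toNNReal hfin] at this

section Lp

variable {n k : ℕ} {M N : Type*}
  [TopologicalSpace M] [SecondCountableTopology M]
  [ChartedSpace (EuclideanSpace ℝ (Fin n)) M] [IsManifold (𝓡 n) ∞ M]
  [MeasurableSpace M] [BorelSpace M]
  [RiemannianBundle (fun x : M => TangentSpace (𝓡 n) x)]
  [IsContMDiffRiemannianBundle (𝓡 n) ∞ (EuclideanSpace ℝ (Fin n))
    (fun x : M => TangentSpace (𝓡 n) x)]
  [TopologicalSpace N] [SecondCountableTopology N]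
  [ChartedSpace (EuclideanSpace ℝ (Fin n)) N] [IsManifold (𝓡 n) ∞ N]
  [MeasurableSpace N] [BorelSpace N]
  [RiemannianBundle (fun y : N => TangentSpace (𝓡 n) y)]
  [IsContMDiffRiemannianBundle (𝓡 n) ∞ (EuclideanSpace ℝ (Fin n))
    (fun y : N => TangentSpace (𝓡 n) y)]

/-- The change of variables formula for `L^p` norms; for `p = ∞` it says that `φ` preserves null
sets. -/
theorem eLpNorm_riemannianMeasure_eq (oM : ManifoldOrientation n M) (oN : ManifoldOrientation n N)
    (φ : M ≃ₘ⟮𝓡 n, 𝓡 n⟯ N) {p : ℝ≥0∞} (hp : p ≠ 0) (g : N → ℝ≥0∞) :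
    eLpNorm g p (riemannianMeasure oN) =
      eLpNorm (fun x => ENNReal.ofReal (jacobian n φ x ^ (1 / p).toReal) * g (φ x)) p
        (riemannianMeasure oM) := by
  have hJ : Measurable fun x => ENNReal.ofReal (jacobian n φ x) :=
    (continuous_jacobian oM oN φ.contMDiff).measurable.ennreal_ofReal
  have hφ : MeasurableEmbedding φ := φ.toHomeomorph.measurableEmbedding
  rw [riemannianMeasure_eq_map_withDensity_jacobian oM oN φ, hφ.eLpNorm_map_measure]
  by_cases hp' : p = ⊤
  · subst hp'
    simp only [eLpNorm_exponent_top, eLpNormEssSup]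
    have hac : riemannianMeasure oM ≪ (riemannianMeasure oM).withDensity
        fun x => ENNReal.ofReal (jacobian n φ x) :=
      withDensity_absolutelyContinuous' hJ.aemeasurable (Filter.Eventually.of_forall fun x => by
        simpa using jacobian_pos φ x)
    simp only [ENNReal.div_top, ENNReal.toReal_zero, Real.rpow_zero, ENNReal.ofReal_one, one_mul]
    exact le_antisymm (essSup_mono_measure (withDensity_absolutelyContinuous _ _))
      (essSup_mono_measure hac)
  · have hpos : 0 < p.toReal := ENNReal.toReal_pos hp hp'
    rw [eLpNorm_eq_lintegral_rpow_enorm_toReal hp hp', eLpNorm_eq_lintegral_rpow_enorm_toReal hp hp',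
      lintegral_withDensity_eq_lintegral_mul_non_measurable _ hJ (by simp)]
    congr 1
    refine lintegral_congr fun x => ?_
    simp only [Pi.mul_apply, Function.comp, enorm_eq_self]
    rw [ENNReal.mul_rpow_of_nonneg _ _ hpos.le,
      ENNReal.ofReal_rpow_of_nonneg (Real.rpow_nonneg (jacobian_nonneg _ _) _) hpos.le,
      ← Real.rpow_mul (jacobian_nonneg _ _), one_div, ENNReal.toReal_inv,
      inv_mul_cancel₀ hpos.ne', Real.rpow_one]

theorem ae_pushforward_eq (oM : ManifoldOrientation n M) (oN : ManifoldOrientation n N)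
    (φ : M ≃ₘ⟮𝓡 n, 𝓡 n⟯ N) {θ θ' : KForm n k M}
    (h : ∀ᵐ x ∂(riemannianMeasure oM), θ' x = θ x) :
    ∀ᵐ y ∂(riemannianMeasure oN), pushforward φ θ' y = pushforward φ θ y := by
  have hφ : MeasurableEmbedding φ := φ.toHomeomorph.measurableEmbedding
  rw [riemannianMeasure_eq_map_withDensity_jacobian oM oN φ, hφ.ae_map_iff]
  refine (withDensity_absolutelyContinuous _ _).ae_le ?_
  filter_upwards [h] with x hx
  have hx' : θ' (φ.symm (φ x)) = θ (φ.symm (φ x)) := by rwa [φ.symm_apply_apply]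
  exact congrArg (fun η => η.compLinearMap (mfderiv (𝓡 n) (𝓡 n) φ.symm (φ x)).toLinearMap) hx'

theorem formNorm_pushforward_le (oM : ManifoldOrientation n M) (oN : ManifoldOrientation n N)
    (φ : M ≃ₘ⟮𝓡 n, 𝓡 n⟯ N) {p : ℝ≥0∞} (hp : p ≠ 0) {t : ℝ} (ht : (1 / p).toReal + t = 1)
    (hk : k ≤ n) (θ : KForm n k M)
    (hfin : eLpNorm (singularProduct n φ (n - k) (1 / p).toReal (-t)) ⊤ (riemannianMeasure oM)
      ≠ ⊤) :
    formNorm oN p (pushforward φ θ) ≤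
      eLpNorm (singularProduct n φ (n - k) (1 / p).toReal (-t)) ⊤ (riemannianMeasure oM) *
        formNorm oM p θ := by
  rw [formNorm, eLpNorm_riemannianMeasure_eq oM oN φ hp]
  refine eLpNorm_le_eLpNorm_top_mul (singularProduct_nonneg φ (Nat.sub_le n k) _ _)
    (fun x => ?_) hfin p
  have hB : 0 < ∏ i ∈ Finset.Ico (n - k) n, singularValue n φ x i := Finset.prod_pos fun _ hi =>
    singularValue_pos φ x (Finset.mem_Ico.1 hi).2
  calc ENNReal.ofReal (jacobian n φ x ^ (1 / p).toReal) * spectralNorm (pushforward φ θ) (φ x)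
      ≤ ENNReal.ofReal (jacobian n φ x ^ (1 / p).toReal) *
          (ENNReal.ofReal (∏ i ∈ Finset.Ico (n - k) n, singularValue n φ x i)⁻¹ *
            spectralNorm θ x) := by
        gcongr
        exact spectralNorm_pushforward_le φ hk θ x
    _ = _ := by
        rw [← mul_assoc, ← ENNReal.ofReal_mul (Real.rpow_nonneg (jacobian_nonneg _ _) _),
          jacobian_rpow_eq_singularProduct_mul φ (Nat.sub_le n k) ht, mul_assoc,
          mul_inv_cancel₀ hB.ne', mul_one]

theorem formNorm_le_mul_formNorm_pushforward (oM : ManifoldOrientation n M)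
    (oN : ManifoldOrientation n N) (φ : M ≃ₘ⟮𝓡 n, 𝓡 n⟯ N) {p : ℝ≥0∞} (hp : p ≠ 0) {t : ℝ}
    (ht : (1 / p).toReal + t = 1) (hk : k ≤ n) (θ : KForm n k M)
    (hfin : eLpNorm (singularProduct n φ k t (-(1 / p).toReal)) ⊤ (riemannianMeasure oM) ≠ ⊤) :
    formNorm oM p θ ≤
      eLpNorm (singularProduct n φ k t (-(1 / p).toReal)) ⊤ (riemannianMeasure oM) *
        formNorm oN p (pushforward φ θ) := by
  rw [formNorm, formNorm, eLpNorm_riemannianMeasure_eq oM oN φ hp]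
  refine eLpNorm_le_eLpNorm_top_mul (singularProduct_nonneg φ hk _ _) (fun x => ?_) hfin p
  rw [← mul_assoc, ← ENNReal.ofReal_mul (singularProduct_nonneg φ hk _ _ x),
    ← prod_singularValue_eq_singularProduct_mul φ hk ht]
  exact spectralNorm_le_prod_mul_pushforward φ θ x

end Lp

end RiemForms

open RiemForms in
theorem mainTheorem4 {n : ℕ} {M N : Type*}
    [TopologicalSpace M] [T2Space M] [SecondCountableTopology M]
    [ChartedSpace (EuclideanSpace ℝ (Fin n)) M] [IsManifold (𝓡 n) ∞ M]
    [MeasurableSpace M] [BorelSpace M]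
    [RiemannianBundle (fun x : M => TangentSpace (𝓡 n) x)]
    [IsContMDiffRiemannianBundle (𝓡 n) ∞ (EuclideanSpace ℝ (Fin n))
      (fun x : M => TangentSpace (𝓡 n) x)]
    [TopologicalSpace N] [T2Space N] [SecondCountableTopology N]
    [ChartedSpace (EuclideanSpace ℝ (Fin n)) N] [IsManifold (𝓡 n) ∞ N]
    [MeasurableSpace N] [BorelSpace N]
    [RiemannianBundle (fun y : N => TangentSpace (𝓡 n) y)]
    [IsContMDiffRiemannianBundle (𝓡 n) ∞ (EuclideanSpace ℝ (Fin n))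
      (fun y : N => TangentSpace (𝓡 n) y)]
    (oM : ManifoldOrientation n M) (oN : ManifoldOrientation n N)
    (φ : M ≃ₘ⟮𝓡 n, 𝓡 n⟯ N) (hφ : IsOrientationPreserving oM oN φ)
    (p q : ℝ≥0∞) (hp : 1 ≤ p) (hq : 1 ≤ q) (hpq : 1 / p + 1 / q = 1)
    (k : ℕ) (hk : k ≤ n)
    (hbdd : ∃ C : ℝ, ∀ x : M,
      singularProduct n φ (n - k) (1 / p).toReal (-(1 / q).toReal) x ≤ C)
    (θ : KForm n k M) (hθ : MemLpForm oM p θ) :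
    -- the pushforward is a well-defined element of `L^p Ω^k(N)`
    MemLpForm oN p (pushforward φ θ) ∧
    (∀ θ' : KForm n k M, (∀ᵐ x ∂(riemannianMeasure oM), θ' x = θ x) →
      ∀ᵐ y ∂(riemannianMeasure oN), pushforward φ θ' y = pushforward φ θ y) ∧
    -- lower bound, where the inverse of an infinite norm is zero
    (eLpNorm (singularProduct n φ k (1 / q).toReal (-(1 / p).toReal)) ⊤ (riemannianMeasure oM))⁻¹
        * formNorm oM p θ ≤ formNorm oN p (pushforward φ θ) ∧
    -- upper bound
    formNorm oN p (pushforward φ θ) ≤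
      eLpNorm (singularProduct n φ (n - k) (1 / p).toReal (-(1 / q).toReal)) ⊤
          (riemannianMeasure oM) * formNorm oM p θ := by
  have hp0 : p ≠ 0 := (zero_lt_one.trans_le hp).ne'
  have hq0 : q ≠ 0 := (zero_lt_one.trans_le hq).ne'
  have hsum : (1 / p).toReal + (1 / q).toReal = 1 := by
    rw [← ENNReal.toReal_add (by simpa using hp0) (by simpa using hq0), hpq, ENNReal.toReal_one]
  have hfin : eLpNorm (singularProduct n φ (n - k) (1 / p).toReal (-(1 / q).toReal)) ⊤
      (riemannianMeasure oM) ≠ ⊤ := by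
    obtain ⟨C, hC⟩ := hbdd
    rw [eLpNorm_exponent_top]
    refine (eLpNormEssSup_lt_top_of_ae_bound (C := C) (Filter.Eventually.of_forall fun x => ?_)).ne
    rw [Real.norm_of_nonneg (singularProduct_nonneg φ (Nat.sub_le n k) _ _ x)]
    exact hC x
  have hupper := formNorm_pushforward_le oM oN φ hp0 hsum hk θ hfin
  refine ⟨⟨hθ.1.pullback φ.symm, hupper.trans_lt (ENNReal.mul_lt_top hfin.lt_top hθ.2)⟩,
    fun θ' h => ae_pushforward_eq oM oN φ h, ?_, hupper⟩
  set c := eLpNorm (singularProduct n φ k (1 / q).toReal (-(1 / p).toReal)) ⊤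
    (riemannianMeasure oM) with hc
  by_cases hct : c = ⊤
  · simp [hct]
  have hlower := formNorm_le_mul_formNorm_pushforward oM oN φ hp0 hsum hk θ hct
  rw [← hc] at hlower
  by_cases hc0 : c = 0
  · -- Then `M` is a null set and `θ` has norm zero, so the convention for `0⁻¹` does not matter.
    rw [hc0, zero_mul, nonpos_iff_eq_zero] at hlower
    simp [hlower]
  · calc c⁻¹ * formNorm oM p θ ≤ c⁻¹ * (c * formNorm oN p (pushforward φ θ)) := by gcongr
      _ = formNorm oN p (pushforward φ θ) := by
        rw [← mul_assoc, ENNReal.inv_mul_cancel hc0 hct, one_mul]
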